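/- All Hilbert spaces are finite dimensional; $d_K=\dim K$. For a Hilbert space $H$, a state is a positive semidefinite operator of trace one on $H$, and an experiment on $H$ is a finite family $\mathcal E=\{\rho_1,\dots,\rho_n\}$ of states on $H$. A channel is a completely positive trace preserving linear map; $\mathcal C(H,K)$ is the set of channels $B(H)\to B(K)$, and, for a $*$-subalgebra $\mathcal D\subseteq B(E)$, $\mathcal C(H,\mathcal D)$ is the set of channels $B(H)\to B(E)$ with values in $\mathcal D$. Let $\mathbb D_N\subseteq B(\mathbb C^N)$ be the algebra of diagonal matrices. For experiments $\mathcal E=\{\rho_1,\dots,\rho_n\}$ on $L$ and $\mathcal F=\{\sigma_1,\dots,\sigma_n\}$ on $L'$, $\mathcal F$ is called $(0,\mathbb D_N)$-deficient with respect to $\mathcal E$, written $\mathcal F\succeq_{0,\mathbb D_N}\mathcal E$, if for all positive semidefinite $G_1,\dots,G_n\in\mathbb D_N$ and every $\alpha\in\mathcal C(L,\mathbb D_N)$ there is $\alpha'\in\mathcal C(L',\mathbb D_N)$ such that $\mathrm{Tr}\,\alpha(\rho_i)G_i\le \mathrm{Tr}\,\alpha'(\sigma_i)G_i$ for all $i=1,\dots,n$.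 Theorem (Chefles). Let $H,K,K'$ be Hilbert spaces with $H\ne\{0\}$, and let $\Phi\in\mathcal C(H,K)$, $\Psi\in\mathcal C(H,K')$. The following are equivalent. (i) $\Phi=\alpha\circ\Psi$ for some channel $\alpha\in\mathcal C(K',K)$. (ii) For every Hilbert space $D$, every experiment $\mathcal E$ on $H\otimes D$ and every $N\in\mathbb N$, $(\Psi\otimes id_D)(\mathcal E)\succeq_{0,\mathbb D_N}(\Phi\otimes id_D)(\mathcal E)$. (iii) There is an experiment $\mathcal E$ on $H\otimes K$ that spans $B(H\otimes K)$ and satisfies $(\Psi\otimes id_K)(\mathcal E)\succeq_{0,\mathbb D_{d_K^2}}(\Phi\otimes id_K)(\mathcal E)$. -/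

import Mathlib

universe u

namespace QChannel

open scoped Kronecker ComplexOrder

/-! A finite dimensional Hilbert space with a fixed orthonormal basis is given by the finite index
type `H` of the basis: the space is `ℂ^H`, `B(H)` is `Matrix H H ℂ`, and the tensor product of the
spaces with index types `H` and `D` is the space with index type `H × D`. -/

/-- The linear map `φ ⊗ id_D : B(H ⊗ D) → B(K ⊗ D)`: apply `φ` to each of the `D × D` blocks. -/
def tensorId {H K : Type*} (D : Type*) (φ : Matrix H H ℂ →ₗ[ℂ] Matrix K K ℂ) :
    Matrix (H × D) (H × D) ℂ →ₗ[ℂ] Matrix (K × D) (K × D) ℂ where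
  toFun X := Matrix.of fun p q => φ (Matrix.of fun i j => X (i, p.2) (j, q.2)) p.1 q.1
  map_add' X Y := by
    ext p q
    have h : (Matrix.of fun i j => (X + Y) (i, p.2) (j, q.2) : Matrix H H ℂ)
        = Matrix.of (fun i j => X (i, p.2) (j, q.2))
          + Matrix.of (fun i j => Y (i, p.2) (j, q.2)) := rfl
    simp only [Matrix.of_apply, Matrix.add_apply] at h ⊢
    rw [h, map_add, Matrix.add_apply]
  map_smul' c X := by
    ext p q
    have h : (Matrix.of fun i j => (c • X) (i, p.2) (j, q.2) : Matrix H H ℂ)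
        = c • Matrix.of (fun i j => X (i, p.2) (j, q.2)) := rfl
    simp only [Matrix.of_apply, Matrix.smul_apply, RingHom.id_apply] at h ⊢
    rw [h, map_smul, Matrix.smul_apply]

/-- `tensorId` is characterized by `(φ ⊗ id_D)(A ⊗ B) = φ(A) ⊗ B`. -/
theorem tensorId_kronecker {H K D : Type*} (φ : Matrix H H ℂ →ₗ[ℂ] Matrix K K ℂ)
    (A : Matrix H H ℂ) (B : Matrix D D ℂ) : tensorId D φ (A ⊗ₖ B) = φ A ⊗ₖ B := by
  ext p q
  have h : (Matrix.of fun i j => (A ⊗ₖ B) (i, p.2) (j, q.2) : Matrix H H ℂ)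
      = B p.2 q.2 • A := by
    ext i j
    simp [mul_comm]
  change φ (Matrix.of fun i j => (A ⊗ₖ B) (i, p.2) (j, q.2)) p.1 q.1 = _
  rw [h, map_smul]
  simp [mul_comm]

/-- Positive maps: `φ(B(H)⁺) ⊆ B(K)⁺`. -/
def IsPositiveMap {H K : Type*} [Fintype H] [Fintype K]
    (φ : Matrix H H ℂ →ₗ[ℂ] Matrix K K ℂ) : Prop :=
  ∀ X : Matrix H H ℂ, X.PosSemidef → (φ X).PosSemidef

/-- Completely positive maps: `φ ⊗ id_F` is positive for every finite dimensional `F`. -/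
def IsCompletelyPositive {H K : Type*} [Fintype H] [Fintype K]
    (φ : Matrix H H ℂ →ₗ[ℂ] Matrix K K ℂ) : Prop :=
  ∀ m : ℕ, IsPositiveMap (tensorId (Fin m) φ)

/-- Channels `B(H) → B(K)`: completely positive trace preserving linear maps. -/
structure IsChannel {H K : Type*} [Fintype H] [Fintype K]
    (φ : Matrix H H ℂ →ₗ[ℂ] Matrix K K ℂ) : Prop where
  completelyPositive : IsCompletelyPositive φ
  trace_preserving : ∀ X : Matrix H H ℂ, (φ X).trace = X.trace

/-- Channels `B(H) → 𝒟` into an algebra `𝒟 ⊆ B(E)`. -/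
structure IsChannelInto {H E : Type*} [Fintype H] [Fintype E] [DecidableEq E]
    (𝒟 : StarSubalgebra ℂ (Matrix E E ℂ)) (φ : Matrix H H ℂ →ₗ[ℂ] Matrix E E ℂ) : Prop where
  isChannel : IsChannel φ
  mem : ∀ X : Matrix H H ℂ, φ X ∈ 𝒟

/-- States, i.e. density matrices. -/
structure IsState {H : Type*} [Fintype H] (ρ : Matrix H H ℂ) : Prop where
  posSemidef : ρ.PosSemidef
  trace_eq_one : ρ.trace = 1

/-- Statistical experiments: finite families of states. -/
def IsExperiment {H : Type*} [Fintype H] {n : ℕ} (ρ : Fin n → Matrix H H ℂ) : Prop :=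
  ∀ i, IsState (ρ i)

/-- The payoff `Tr α(ρ_i) G_i` (a real number for positive `ρ_i`, `G_i` and a channel `α`). -/
noncomputable def payoff {H E : Type*} [Fintype E] {n : ℕ} (ρ : Fin n → Matrix H H ℂ)
    (i : Fin n) (α : Matrix H H ℂ →ₗ[ℂ] Matrix E E ℂ) (G : Fin n → Matrix E E ℂ) : ℝ :=
  (α (ρ i) * G i).trace.re

/-- The experiment `σ` is `(ε, 𝒟)`-deficient with respect to the experiment `ρ`. The norm is the
operator norm. -/
def IsDeficient {H H' E : Type*} [Fintype H] [Fintype H'] [Fintype E] [DecidableEq E] {n : ℕ}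
    (ε : ℝ) (𝒟 : StarSubalgebra ℂ (Matrix E E ℂ))
    (σ : Fin n → Matrix H' H' ℂ) (ρ : Fin n → Matrix H H ℂ) : Prop :=
  ∀ G : Fin n → Matrix E E ℂ, (∀ i, G i ∈ 𝒟 ∧ (G i).PosSemidef) →
    ∀ α : Matrix H H ℂ →ₗ[ℂ] Matrix E E ℂ, IsChannelInto 𝒟 α →
      ∃ α' : Matrix H' H' ℂ →ₗ[ℂ] Matrix E E ℂ, IsChannelInto 𝒟 α' ∧
        ∀ i, payoff ρ i α G ≤ payoff σ i α' G + ε * ‖Matrix.toEuclideanCLM (𝕜 := ℂ) (G i)‖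

/-- The classical decision algebra `𝔻_N`: the diagonal matrices in `B(ℂ^N)`. -/
def diagAlgebra (N : ℕ) : StarSubalgebra ℂ (Matrix (Fin N) (Fin N) ℂ) where
  carrier := {X | X.IsDiag}
  mul_mem' {X Y} hX hY := by
    have hX' : X.IsDiag := hX
    have hY' : Y.IsDiag := hY
    change (X * Y).IsDiag
    rw [← hX'.diagonal_diag, ← hY'.diagonal_diag, Matrix.diagonal_mul_diagonal]
    exact Matrix.isDiag_diagonal _
  add_mem' {X Y} hX hY := Matrix.IsDiag.add hX hY
  algebraMap_mem' c := by
    change (algebraMap ℂ (Matrix (Fin N) (Fin N) ℂ) c).IsDiag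
    rw [Matrix.algebraMap_eq_diagonal]
    exact Matrix.isDiag_diagonal _
  star_mem' {X} hX := Matrix.IsDiag.conjTranspose hX

end QChannel

/-! The substance is (iii) ⇒ (i): (i) ⇒ (ii) composes a decision map with `α ⊗ id`, and (ii) ⇒ (iii)
needs only that finitely many states span. The maps `β ∘ Ψ`, `β` a channel, form a compact convex
set, so by Hahn-Banach (`exists_comp_of_forall_entangledPairing_le`) it suffices that for every
functional some `β ∘ Ψ` does at least as well as `Φ`. Every functional has the form φ ↦ ⟨Ω, (φ ⊗
id)(X) Ω⟩ with Ω = ∑ k ⊗ k.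

To read off this pairing by a classical decision, take the d² Weyl unitaries `U x`, d = d_K, and
measure in their Bell basis. On the image of the twisted operator (1 ⊗ (U x)ᴴ) X (1 ⊗ U x), outcome
x has value d⁻¹ times the pairing (`bellMap_mulRight`). The twisted operators are combinations of
the spanning states, and the real parts of the coefficients, shifted to be nonnegative, serve as
diagonal payoffs (`IsDeficient.exists_re_sum_le`). Deficiency returns a decision `α` for Ψ, which
teleportation turns into a channel `β` whose pairing is d⁻¹ times the total value of `α`
(`entangledPairing_teleport`). -/

namespace QChannel

open scoped Kronecker ComplexOrder Matrix

/-! ### Ancillas, composition and states -/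

section Basics

variable {H K L D E : Type*}

theorem tensorId_apply (φ : Matrix H H ℂ →ₗ[ℂ] Matrix K K ℂ) (X : Matrix (H × D) (H × D) ℂ)
    (p q : K × D) :
    tensorId D φ X p q = φ (Matrix.of fun i j => X (i, p.2) (j, q.2)) p.1 q.1 := rfl

theorem tensorId_comp (φ : Matrix K K ℂ →ₗ[ℂ] Matrix L L ℂ)
    (ψ : Matrix H H ℂ →ₗ[ℂ] Matrix K K ℂ) :
    tensorId D (φ ∘ₗ ψ) = tensorId D φ ∘ₗ tensorId D ψ := rfl

theorem tensorId_submatrix (φ : Matrix H H ℂ →ₗ[ℂ] Matrix K K ℂ) (e : E → D)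
    (X : Matrix (H × D) (H × D) ℂ) :
    tensorId E φ (X.submatrix (Prod.map id e) (Prod.map id e)) =
      (tensorId D φ X).submatrix (Prod.map id e) (Prod.map id e) := rfl

/-- Two successive ancillas act as one larger ancilla, which makes complete positivity stable under
tensoring. -/
theorem tensorId_tensorId (φ : Matrix H H ℂ →ₗ[ℂ] Matrix K K ℂ)
    (X : Matrix ((H × E) × D) ((H × E) × D) ℂ) :
    tensorId D (tensorId E φ) X =
      (tensorId (E × D) φ (X.submatrix (Equiv.prodAssoc H E D).symm
        (Equiv.prodAssoc H E D).symm)).submatrix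
        (Equiv.prodAssoc K E D) (Equiv.prodAssoc K E D) := rfl

variable [Fintype H] [Fintype K] [Fintype L] [Fintype D] [Fintype E]

/-- Complete positivity may be tested with any finite ancilla. -/
theorem IsCompletelyPositive.isPositiveMap {φ : Matrix H H ℂ →ₗ[ℂ] Matrix K K ℂ}
    (hφ : IsCompletelyPositive φ) (D : Type*) [Fintype D] : IsPositiveMap (tensorId D φ) := by
  intro X hX
  let e := Fintype.equivFin D
  have h := (hφ _ _ (hX.submatrix (Prod.map id e.symm))).submatrix (Prod.map id e)
  rw [tensorId_submatrix, Matrix.submatrix_submatrix] at h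
  simpa [Prod.map_comp_map] using h

theorem IsCompletelyPositive.comp {φ : Matrix K K ℂ →ₗ[ℂ] Matrix L L ℂ}
    {ψ : Matrix H H ℂ →ₗ[ℂ] Matrix K K ℂ} (hφ : IsCompletelyPositive φ)
    (hψ : IsCompletelyPositive ψ) : IsCompletelyPositive (φ ∘ₗ ψ) :=
  fun m X hX => hφ m _ (hψ m X hX)

theorem IsCompletelyPositive.tensorId {φ : Matrix H H ℂ →ₗ[ℂ] Matrix K K ℂ}
    (hφ : IsCompletelyPositive φ) : IsCompletelyPositive (tensorId D φ) := by
  intro m X hX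
  rw [tensorId_tensorId]
  exact ((hφ.isPositiveMap (D × Fin m)) _ (hX.submatrix _)).submatrix _

theorem trace_tensorId {φ : Matrix H H ℂ →ₗ[ℂ] Matrix K K ℂ}
    (hφ : ∀ X, (φ X).trace = X.trace) (X : Matrix (H × D) (H × D) ℂ) :
    (tensorId D φ X).trace = X.trace := by
  simp only [Matrix.trace, Matrix.diag_apply, Fintype.sum_prod_type_right, tensorId_apply]
  exact Finset.sum_congr rfl fun d _ => hφ _

theorem IsChannel.comp {φ : Matrix K K ℂ →ₗ[ℂ] Matrix L L ℂ}
    {ψ : Matrix H H ℂ →ₗ[ℂ] Matrix K K ℂ} (hφ : IsChannel φ) (hψ : IsChannel ψ) :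
    IsChannel (φ ∘ₗ ψ) :=
  ⟨hφ.1.comp hψ.1, fun X => (hφ.2 _).trans (hψ.2 X)⟩

theorem IsChannel.tensorId {φ : Matrix H H ℂ →ₗ[ℂ] Matrix K K ℂ} (hφ : IsChannel φ) :
    IsChannel (tensorId D φ) :=
  ⟨hφ.1.tensorId, trace_tensorId hφ.2⟩

theorem IsCompletelyPositive.posSemidef {φ : Matrix H H ℂ →ₗ[ℂ] Matrix K K ℂ}
    (hφ : IsCompletelyPositive φ) {X : Matrix H H ℂ} (hX : X.PosSemidef) :
    (φ X).PosSemidef := by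
  have h := hφ.isPositiveMap Unit _ (hX.submatrix (Prod.fst : H × Unit → H))
  exact h.submatrix (fun k => (k, ()))

theorem IsChannel.isState {φ : Matrix H H ℂ →ₗ[ℂ] Matrix K K ℂ} (hφ : IsChannel φ)
    {ρ : Matrix H H ℂ} (hρ : IsState ρ) : IsState (φ ρ) :=
  ⟨hφ.1.posSemidef hρ.1, (hφ.2 ρ).trans hρ.2⟩

end Basics

/-- Postprocessing can only decrease the information in an experiment. -/
theorem isDeficient_of_comp {H K L D : Type*} [Fintype K] [Fintype L] [Fintype D] {n N : ℕ}
    {Φ : Matrix H H ℂ →ₗ[ℂ] Matrix K K ℂ}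
    {Ψ : Matrix H H ℂ →ₗ[ℂ] Matrix L L ℂ} {α : Matrix L L ℂ →ₗ[ℂ] Matrix K K ℂ}
    (hα : IsChannel α) (h : Φ = α ∘ₗ Ψ) (ρ : Fin n → Matrix (H × D) (H × D) ℂ) :
    IsDeficient 0 (diagAlgebra N) (fun i => tensorId D Ψ (ρ i))
      (fun i => tensorId D Φ (ρ i)) := by
  intro G _ β hβ
  -- With this witness the payoffs are equal.
  refine ⟨β ∘ₗ tensorId D α, ⟨hβ.1.comp hα.tensorId, fun X => hβ.2 _⟩, fun i => ?_⟩
  subst h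
  simp [payoff, tensorId_comp]

/-! ### Maps in Kraus form -/

section Kraus

variable {H K D ι : Type*} [Fintype H] [Fintype ι]

/-- The completely positive map `X ↦ ∑ x, B x * X * (B x)ᴴ`. -/
def krausMap (B : ι → Matrix K H ℂ) : Matrix H H ℂ →ₗ[ℂ] Matrix K K ℂ where
  toFun X := ∑ x, B x * X * (B x)ᴴ
  map_add' X Y := by simp [Matrix.mul_add, Matrix.add_mul, Finset.sum_add_distrib]
  map_smul' c X := by simp [Finset.smul_sum]

theorem krausMap_apply (B : ι → Matrix K H ℂ) (X : Matrix H H ℂ) :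
    krausMap B X = ∑ x, B x * X * (B x)ᴴ := rfl

theorem tensorId_krausMap [Fintype D] [DecidableEq D] (B : ι → Matrix K H ℂ)
    (X : Matrix (H × D) (H × D) ℂ) :
    tensorId D (krausMap B) X =
      ∑ x, (B x ⊗ₖ (1 : Matrix D D ℂ)) * X * (B x ⊗ₖ (1 : Matrix D D ℂ))ᴴ := by
  ext p q
  simp only [tensorId_apply, krausMap_apply, Matrix.sum_apply]
  refine Finset.sum_congr rfl fun x _ => ?_
  simp [Matrix.mul_apply, Fintype.sum_prod_type, Matrix.kroneckerMap_apply,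
    Matrix.one_apply, apply_ite (star : ℂ → ℂ)]

theorem isCompletelyPositive_krausMap [Fintype K] (B : ι → Matrix K H ℂ) :
    IsCompletelyPositive (krausMap B) := by
  intro m X hX
  rw [tensorId_krausMap]
  exact Matrix.posSemidef_sum _ fun x _ => hX.mul_mul_conjTranspose_same _

end Kraus

/-! ### Positive matrices, spanning states and Weyl unitaries -/

/-- Over `ℂ`, a matrix with nonnegative quadratic form is positive semidefinite. -/
theorem posSemidef_of_dotProduct_mulVec_nonneg {n : Type*} [Fintype n] {M : Matrix n n ℂ}
    (h : ∀ x, 0 ≤ star x ⬝ᵥ (M *ᵥ x)) : M.PosSemidef := by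
  classical
  -- Over `ℂ` a real-valued quadratic form already forces self-adjointness.
  rw [← Matrix.isPositive_toEuclideanLin_iff, LinearMap.isPositive_iff_complex]
  intro x
  have hx := h x.ofLp
  rw [Complex.nonneg_iff] at hx
  have : inner ℂ (Matrix.toEuclideanLin M x) x = star (star x.ofLp ⬝ᵥ (M *ᵥ x.ofLp)) := by
    rw [Matrix.toLpLin_apply, EuclideanSpace.inner_eq_star_dotProduct]
    rw [← Matrix.star_dotProduct, dotProduct_comm]
  rw [this]
  constructor
  · apply Complex.ext
    · simp
    · simp [← hx.2]
  · simpa using hx.1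

/-- The entries of a positive semidefinite matrix are bounded by its diagonal entries. -/
theorem norm_apply_sq_le {n : Type*} [Fintype n] {M : Matrix n n ℂ}
    (h : M.PosSemidef) (p q : n) : ‖M p q‖ ^ 2 ≤ (M p p).re * (M q q).re := by
  -- The bound is nonnegativity of a 2 × 2 principal minor; `p = q` is allowed.
  have hd := (h.submatrix ![p, q]).det_nonneg
  rw [Matrix.det_fin_two] at hd
  simp only [Matrix.submatrix_apply, Matrix.cons_val_zero, Matrix.cons_val_one] at hd
  have h1 : M q p = star (M p q) := (h.1.apply q p).symm
  have h2 := (Complex.nonneg_iff.1 (h.diag_nonneg (i := p))).2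
  have h3 := (Complex.nonneg_iff.1 hd).1
  rw [h1, Complex.star_def, Complex.mul_conj, Complex.sub_re, Complex.mul_re, ← h2,
    Complex.ofReal_re, Complex.normSq_eq_norm_sq] at h3
  linarith

/-- The states span all matrices. -/
theorem span_isState (H : Type*) [Fintype H] :
    Submodule.span ℂ {ρ : Matrix H H ℂ | IsState ρ} = ⊤ := by
  classical
  have key : Submodule.span ℂ {X : Matrix H H ℂ | X.PosSemidef} = ⊤ := by
    open scoped Matrix.Norms.L2Operator MatrixOrder in
    have := CStarAlgebra.span_nonneg (A := Matrix H H ℂ)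
    simpa only [Matrix.nonneg_iff_posSemidef] using this
  rw [eq_top_iff, ← key, Submodule.span_le]
  intro X hX
  have hX' : X.PosSemidef := hX
  by_cases h0 : X.trace = 0
  · rw [hX'.trace_eq_zero_iff.1 h0]
    exact Submodule.zero_mem _
  · have : X = X.trace • (X.trace⁻¹ • X) := by rw [smul_smul, mul_inv_cancel₀ h0, one_smul]
    rw [this]
    refine Submodule.smul_mem _ _ (Submodule.subset_span ⟨?_, ?_⟩)
    · exact hX'.smul (inv_nonneg.2 hX'.trace_nonneg)
    · simp [h0]

theorem exists_isExperiment_span_eq_top (H : Type*) [Fintype H] :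
    ∃ (n : ℕ) (ρ : Fin n → Matrix H H ℂ), IsExperiment ρ ∧
      Submodule.span ℂ (Set.range ρ) = ⊤ := by
  classical
  obtain ⟨t, hts, -, ht, -⟩ :=
    Submodule.exists_finset_span_eq_linearIndepOn ℂ {ρ : Matrix H H ℂ | IsState ρ}
  refine ⟨t.card, fun i => (t.equivFin.symm i : Matrix H H ℂ), fun i => hts (t.equivFin.symm i).2,
    ?_⟩
  rw [← span_isState, ← ht]
  congr 1
  ext x
  simp only [Set.mem_range, Finset.mem_coe]
  exact ⟨fun ⟨i, hi⟩ => hi ▸ (t.equivFin.symm i).2, fun hx => ⟨t.equivFin ⟨x, hx⟩, by simp⟩⟩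

/-- Heisenberg-Weyl unitaries: a unitary orthogonal basis of `B(K)`. -/
theorem exists_weyl (K : Type*) [Fintype K] [DecidableEq K] [Nonempty K] :
    ∃ U : Fin (Fintype.card K ^ 2) → Matrix K K ℂ, (∀ x, U x * (U x)ᴴ = 1) ∧
      ∀ k p l q, ∑ x, U x k p * star (U x l q) =
        if k = l ∧ p = q then (Fintype.card K : ℂ) else 0 := by
  have : NeZero (Fintype.card K) := ⟨Fintype.card_ne_zero⟩
  let e : K ≃ ZMod (Fintype.card K) := Fintype.equivOfCardEq (by simp [ZMod.card])
  let g : Fin (Fintype.card K ^ 2) ≃ ZMod (Fintype.card K) × ZMod (Fintype.card K) :=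
    Fintype.equivOfCardEq (by simp [ZMod.card, sq])
  let χ : AddChar (ZMod (Fintype.card K)) ℂ := ZMod.stdAddChar
  have hχ : ∀ a, star (χ a) = χ (-a) := fun a => (AddChar.map_neg_eq_conj χ a).symm
  -- Shift by `x.1` after the phase `χ (x.2 * ·)`.
  let W : ZMod (Fintype.card K) × ZMod (Fintype.card K) → Matrix K K ℂ := fun x =>
    Matrix.of fun k p => if e k = e p + x.1 then χ (x.2 * e p) else 0
  refine ⟨fun x => W (g x), fun x => ?_, fun k p l q => ?_⟩
  · ext k l
    rw [Matrix.mul_apply, Finset.sum_eq_single (e.symm (e k - (g x).1))]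
    · by_cases h : k = l
      · subst h
        simp [W, hχ, ← AddChar.map_add_eq_mul]
      · have : e l ≠ e k := fun h' => h (e.injective h').symm
        simp [W, h, this]
    · intro p _ hp
      have : e k ≠ e p + (g x).1 := fun h => hp (by simp [h])
      simp [W, this]
    · simp
  · rw [g.sum_comp (fun y => W y k p * star (W y l q)), Fintype.sum_prod_type]
    have h1 : ∀ a b, W (a, b) k p * star (W (a, b) l q) =
        if e k = e p + a ∧ e l = e q + a then χ (b * (e p - e q)) else 0 := by
      intro a b
      by_cases h : e k = e p + a <;> by_cases h' : e l = e q + a <;>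
        simp [W, h, h', hχ, ← AddChar.map_add_eq_mul, mul_sub, ← sub_eq_add_neg]
    simp only [h1]
    -- Only the shift `a = e k - e p = e l - e q` contributes; the character sum over `b` then
    -- vanishes unless `p = q`, which in turn forces `k = l`.
    have h2 : ∀ a, (∑ b, if e k = e p + a ∧ e l = e q + a then χ (b * (e p - e q)) else 0) =
        if a = e k - e p then (if k = l ∧ p = q then (Fintype.card K : ℂ) else 0) else 0 := by
      intro a
      have hs := AddChar.sum_mulShift (e p - e q) (ZMod.isPrimitive_stdAddChar (Fintype.card K))
      by_cases hpq : p = q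
      · subst hpq
        by_cases hkl : k = l
        · subst hkl
          by_cases ha : a = e k - e p
          · subst ha
            simp
          · have : e k ≠ e p + a := fun h => ha (by simp [h])
            simp [ha, this]
        · have : ¬ (e k = e p + a ∧ e l = e p + a) :=
            fun h => hkl (e.injective (h.1.trans h.2.symm))
          simp [hkl, this]
      · have : e p - e q ≠ 0 := fun h => hpq (e.injective (sub_eq_zero.1 h))
        rw [if_neg this] at hs
        by_cases hc : e k = e p + a ∧ e l = e q + a
        · simp only [hc, and_self, if_true, hpq, and_false, if_false, ite_self]
          simpa [χ] using hs
        · simp [hc, hpq]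
    simp [h2]

/-! ### Operations on the second tensor factor -/

section Blocks

variable {H K L : Type*}

/-- The block of a matrix on `H ⊗ K` at position `(k, l)` of the second factor. -/
def block (X : Matrix (H × K) (H × K) ℂ) (k l : K) : Matrix H H ℂ :=
  Matrix.of fun i j => X (i, k) (j, l)

theorem block_tensorId (φ : Matrix H H ℂ →ₗ[ℂ] Matrix L L ℂ) (X : Matrix (H × K) (H × K) ℂ)
    (k l : K) : block (tensorId K φ X) k l = φ (block X k l) := rfl

variable [Fintype H] [DecidableEq H] [Fintype K] [DecidableEq K] [Fintype L] [DecidableEq L]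

/-- Multiplying the second tensor factor from both sides. -/
def mulRight (H : Type*) {K : Type*} [Fintype H] [DecidableEq H] [Fintype K]
    (A B : Matrix K K ℂ) (X : Matrix (H × K) (H × K) ℂ) : Matrix (H × K) (H × K) ℂ :=
  ((1 : Matrix H H ℂ) ⊗ₖ A) * X * ((1 : Matrix H H ℂ) ⊗ₖ B)

theorem mulRight_eq_sum (A B : Matrix K K ℂ) (X : Matrix (H × K) (H × K) ℂ) :
    mulRight H A B X = ∑ k, ∑ l, block X k l ⊗ₖ (A * Matrix.single k l 1 * B) := by
  have h : X = ∑ k, ∑ l, block X k l ⊗ₖ Matrix.single k l (1 : ℂ) := by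
    ext ⟨i, a⟩ ⟨j, b⟩
    simp only [Matrix.sum_apply, Matrix.kroneckerMap_apply, block, Matrix.of_apply,
      Matrix.single_apply]
    rw [Finset.sum_eq_single a, Finset.sum_eq_single b] <;> simp +contextual
  conv_lhs => rw [h]
  simp only [mulRight, Finset.mul_sum, Finset.sum_mul]
  refine Finset.sum_congr rfl fun k _ => Finset.sum_congr rfl fun l _ => ?_
  rw [← Matrix.mul_kronecker_mul, ← Matrix.mul_kronecker_mul, one_mul, mul_one]

/-- Operations on different tensor factors commute. -/
theorem tensorId_mulRight (φ : Matrix H H ℂ →ₗ[ℂ] Matrix L L ℂ) (A B : Matrix K K ℂ)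
    (X : Matrix (H × K) (H × K) ℂ) :
    tensorId K φ (mulRight H A B X) = mulRight L A B (tensorId K φ X) := by
  simp only [mulRight_eq_sum, map_sum, tensorId_kronecker, block_tensorId]

end Blocks

/-- The pairing with the (unnormalized) maximally entangled vector. -/
def entangledPairing {K : Type*} [Fintype K] (X : Matrix (K × K) (K × K) ℂ) : ℂ :=
  ∑ k, ∑ l, X (k, k) (l, l)

theorem entangledPairing_tensorId {H K : Type*} [Fintype K] (φ : Matrix H H ℂ →ₗ[ℂ] Matrix K K ℂ)
    (X : Matrix (H × K) (H × K) ℂ) :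
    entangledPairing (tensorId K φ X) = ∑ k, ∑ l, φ (block X k l) k l := rfl

/-! ### The Bell measurement -/

section Bell

variable {K : Type*} [Fintype K] {N : ℕ}

/-- The operator `|x⟩⟨A|`. -/
def bellRow (x : Fin N) (A : Matrix K K ℂ) : Matrix (Fin N) (K × K) ℂ :=
  Matrix.of fun y p => if y = x then A p.1 p.2 else 0

theorem bellRow_mul_mul_apply (x : Fin N) (A : Matrix K K ℂ) (Y : Matrix (K × K) (K × K) ℂ)
    (y z : Fin N) : (bellRow x A * Y * (bellRow x A)ᴴ) y z =
      if y = x ∧ z = x then ∑ p, ∑ q, A p.1 p.2 * Y p q * star (A q.1 q.2) else 0 := by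
  by_cases hy : y = x <;> by_cases hz : z = x <;>
    simp [bellRow, Matrix.mul_apply, hy, hz, Finset.sum_mul]
  exact Finset.sum_comm

theorem bellRow_mul [DecidableEq K] (x : Fin N) (A B : Matrix K K ℂ) :
    bellRow x A * ((1 : Matrix K K ℂ) ⊗ₖ B) = bellRow x (A * B) := by
  ext y ⟨k, p⟩
  by_cases h : y = x <;>
    simp [bellRow, Matrix.mul_apply, Fintype.sum_prod_type, Matrix.one_apply, h]

/-- The measurement in the maximally entangled basis given by `U`. -/
noncomputable def bellMap (U : Fin N → Matrix K K ℂ) :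
    Matrix (K × K) (K × K) ℂ →ₗ[ℂ] Matrix (Fin N) (Fin N) ℂ :=
  (Fintype.card K : ℂ)⁻¹ • krausMap fun x => bellRow x (U x)

theorem bellMap_apply (U : Fin N → Matrix K K ℂ) (Y : Matrix (K × K) (K × K) ℂ) (x : Fin N) :
    bellMap U Y x x = (Fintype.card K : ℂ)⁻¹ * (bellRow x (U x) * Y * (bellRow x (U x))ᴴ) x x := by
  simp only [bellMap, LinearMap.smul_apply, krausMap_apply, Matrix.smul_apply, Matrix.sum_apply,
    smul_eq_mul]
  rw [Finset.sum_eq_single x]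
  · intro b _ hb
    simp [bellRow_mul_mul_apply, hb.symm]
  · simp

/-- The twist by `U x` cancels the unitary in the Bell vector of outcome `x`, leaving the vector of
the identity. Hence every outcome gives the same value. -/
theorem bellMap_mulRight [DecidableEq K] (U : Fin N → Matrix K K ℂ) (hU : ∀ x, U x * (U x)ᴴ = 1)
    (Z : Matrix (K × K) (K × K) ℂ) (x : Fin N) :
    bellMap U (mulRight K (U x)ᴴ (U x) Z) x x =
      (Fintype.card K : ℂ)⁻¹ * entangledPairing Z := by
  have h : bellRow x (U x) * mulRight K (U x)ᴴ (U x) Z * (bellRow x (U x))ᴴ =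
      (bellRow x (U x) * ((1 : Matrix K K ℂ) ⊗ₖ (U x)ᴴ)) * Z *
        (bellRow x (U x) * ((1 : Matrix K K ℂ) ⊗ₖ (U x)ᴴ))ᴴ := by
    simp only [mulRight, Matrix.conjTranspose_mul, Matrix.conjTranspose_kronecker,
      Matrix.conjTranspose_one, Matrix.conjTranspose_conjTranspose, Matrix.mul_assoc]
  rw [bellMap_apply, h, bellRow_mul, hU, bellRow_mul_mul_apply]
  simp [entangledPairing, Fintype.sum_prod_type, Matrix.one_apply]

/-- The completeness relation of the unitaries says that the Bell effects sum to the identity, which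
is trace preservation. -/
theorem isChannelInto_bellMap [DecidableEq K] [Nonempty K] {U : Fin N → Matrix K K ℂ}
    (hU : ∀ k p l q, ∑ x, U x k p * star (U x l q) =
        if k = l ∧ p = q then (Fintype.card K : ℂ) else 0) :
    IsChannelInto (diagAlgebra N) (bellMap U) := by
  refine ⟨⟨fun m X hX => ?_, fun X => ?_⟩, fun X => ?_⟩
  · have hc : (0 : ℂ) ≤ (Fintype.card K : ℂ)⁻¹ := inv_nonneg.2 (Nat.cast_nonneg _)
    exact (isCompletelyPositive_krausMap (fun x => bellRow x (U x)) m X hX).smul hc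
  · have hK : (Fintype.card K : ℂ) ≠ 0 := Nat.cast_ne_zero.2 Fintype.card_ne_zero
    simp only [Matrix.trace, Matrix.diag_apply, bellMap_apply, bellRow_mul_mul_apply, and_self,
      if_true]
    rw [← Finset.mul_sum, Finset.sum_comm, inv_mul_eq_iff_eq_mul₀ hK, Finset.mul_sum]
    refine Finset.sum_congr rfl fun p _ => ?_
    rw [Finset.sum_comm]
    have h : ∀ q, ∑ x, U x p.1 p.2 * X p q * star (U x q.1 q.2) =
        if p = q then (Fintype.card K : ℂ) * X p p else 0 := by
      intro q
      have : ∀ x, U x p.1 p.2 * X p q * star (U x q.1 q.2) =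
          X p q * (U x p.1 p.2 * star (U x q.1 q.2)) := fun x => by ring
      simp only [this, ← Finset.mul_sum, hU, Prod.ext_iff]
      split_ifs with h
      · rw [show q = p from Prod.ext h.1.symm h.2.symm, mul_comm]
      · simp
    simp only [h, Finset.sum_ite_eq, Finset.mem_univ, if_true]
  · intro y z hyz
    simp only [bellMap, LinearMap.smul_apply, krausMap_apply, Matrix.smul_apply, Matrix.sum_apply,
      bellRow_mul_mul_apply]
    rw [Finset.sum_eq_zero, smul_zero]
    intro x _
    rw [if_neg]
    rintro ⟨rfl, rfl⟩
    exact hyz rfl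

end Bell

/-! ### From measurements to channels by teleportation -/

section Teleportation

theorem sum_comm_reverse {ι₁ ι₂ ι₃ ι₄ M : Type*} [Fintype ι₁] [Fintype ι₂] [Fintype ι₃]
    [Fintype ι₄] [AddCommMonoid M] (f : ι₁ → ι₂ → ι₃ → ι₄ → M) :
    ∑ d, ∑ c, ∑ b, ∑ a, f a b c d = ∑ a, ∑ b, ∑ c, ∑ d, f a b c d := by
  have h (c : ι₃) (d : ι₄) : ∑ b, ∑ a, f a b c d = ∑ p : ι₁ × ι₂, f p.1 p.2 c d := by
    rw [Fintype.sum_prod_type, Finset.sum_comm]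
  have h' (p : ι₁ × ι₂) : ∑ c, ∑ d, f p.1 p.2 c d = ∑ d, ∑ c, f p.1 p.2 c d := Finset.sum_comm
  simp only [h]
  rw [← Fintype.sum_prod_type' (f := fun a b => ∑ c, ∑ d, f a b c d)]
  simp only [h']
  symm
  rw [Finset.sum_comm]
  exact Finset.sum_congr rfl fun d _ => Finset.sum_comm

variable {H K L : Type*} [Fintype K] [DecidableEq K] {N : ℕ}

/-- Teleportation turns a measurement on `L ⊗ K` into a map `B(L) → B(K)`. -/
noncomputable def teleport (U : Fin N → Matrix K K ℂ)
    (α : Matrix (L × K) (L × K) ℂ →ₗ[ℂ] Matrix (Fin N) (Fin N) ℂ) :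
    Matrix L L ℂ →ₗ[ℂ] Matrix K K ℂ where
  toFun Y := Matrix.of fun k l => (Fintype.card K : ℂ)⁻¹ *
    ∑ x, α (Y ⊗ₖ ((U x)ᴴ * Matrix.single k l 1 * U x)) x x
  map_add' X Y := by
    ext k l
    simp [Matrix.add_kronecker, Finset.sum_add_distrib, mul_add]
  map_smul' c X := by
    ext k l
    simp [Matrix.smul_kronecker, ← Finset.mul_sum, mul_left_comm]

theorem teleport_apply (U : Fin N → Matrix K K ℂ)
    (α : Matrix (L × K) (L × K) ℂ →ₗ[ℂ] Matrix (Fin N) (Fin N) ℂ) (Y : Matrix L L ℂ) (k l : K) :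
    teleport U α Y k l = (Fintype.card K : ℂ)⁻¹ *
      ∑ x, α (Y ⊗ₖ ((U x)ᴴ * Matrix.single k l 1 * U x)) x x := rfl

variable [Fintype L]

/-- The counterpart of `bellMap_mulRight`: the definition of `teleport` is chosen so that this holds
for an arbitrary `α`. -/
theorem entangledPairing_teleport [DecidableEq L] (U : Fin N → Matrix K K ℂ)
    (α : Matrix (L × K) (L × K) ℂ →ₗ[ℂ] Matrix (Fin N) (Fin N) ℂ)
    (Z : Matrix (L × K) (L × K) ℂ) :
    entangledPairing (tensorId K (teleport U α) Z) =
      (Fintype.card K : ℂ)⁻¹ * ∑ x, α (mulRight L (U x)ᴴ (U x) Z) x x := by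
  simp only [entangledPairing_tensorId, teleport_apply, mulRight_eq_sum, map_sum,
    Matrix.sum_apply, ← Finset.mul_sum]
  congr 1
  symm
  rw [Finset.sum_comm]
  exact Finset.sum_congr rfl fun k _ => Finset.sum_comm

/-- The ancilla is absorbed into the input of `α`: the quadratic form at `w` is a nonnegative
combination of diagonal entries of `α (W x * Z * (W x)ᴴ)`, so plain positivity of `α` suffices. -/
theorem isCompletelyPositive_teleport (U : Fin N → Matrix K K ℂ)
    {α : Matrix (L × K) (L × K) ℂ →ₗ[ℂ] Matrix (Fin N) (Fin N) ℂ} (hα : IsPositiveMap α) :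
    IsCompletelyPositive (teleport U α) := by
  classical
  intro m Z hZ
  refine posSemidef_of_dotProduct_mulVec_nonneg fun w => ?_
  -- `W x` is the identity on `L` tensored with the operator from the ancilla to `K` obtained by
  -- contracting `w` with `U x`.
  let W : Fin N → Matrix (L × K) (L × Fin m) ℂ := fun x => Matrix.of fun p q =>
    if p.1 = q.1 then ∑ k, star (U x k p.2) * star (w (k, q.2)) else 0
  have h0 : ∀ x k l a b, ((U x)ᴴ * Matrix.single k l (1 : ℂ) * U x : Matrix K K ℂ) a b =
      star (U x k a) * U x l b := by
    intro x k l a b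
    simp [Matrix.mul_apply, Matrix.single_apply, ite_and]
  have hW : ∀ x, W x * Z * (W x)ᴴ = ∑ p : K × Fin m, ∑ q : K × Fin m,
      (star (w p) * w q) • (block Z p.2 q.2 ⊗ₖ ((U x)ᴴ * Matrix.single p.1 q.1 1 * U x)) := by
    intro x
    ext ⟨i, a⟩ ⟨j, b⟩
    simp [W, Matrix.mul_apply, Fintype.sum_prod_type, Matrix.sum_apply, block, h0,
      apply_ite (starRingEnd ℂ), Finset.sum_mul, Finset.mul_sum]
    rw [sum_comm_reverse]
    refine Finset.sum_congr rfl fun k _ => Finset.sum_congr rfl fun a _ =>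
      Finset.sum_congr rfl fun l _ => Finset.sum_congr rfl fun b _ => ?_
    ring
  have : star w ⬝ᵥ (tensorId (Fin m) (teleport U α) Z *ᵥ w) =
      (Fintype.card K : ℂ)⁻¹ * ∑ x, α (W x * Z * (W x)ᴴ) x x := by
    simp only [hW, map_sum, map_smul, Matrix.sum_apply, Matrix.smul_apply, dotProduct,
      Matrix.mulVec, Finset.mul_sum, tensorId_apply, teleport_apply, Pi.star_apply, smul_eq_mul]
    symm
    rw [Finset.sum_comm]
    refine Finset.sum_congr rfl fun p _ => ?_
    rw [Finset.sum_comm]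
    refine Finset.sum_congr rfl fun q _ => ?_
    rw [Finset.sum_mul, Finset.mul_sum]
    refine Finset.sum_congr rfl fun x _ => ?_
    simp only [block]
    ring
  rw [this]
  exact mul_nonneg (inv_nonneg.2 (Nat.cast_nonneg _)) (Finset.sum_nonneg fun x _ =>
    (hα _ (hZ.mul_mul_conjTranspose_same (W x))).diag_nonneg)

/-- Since the conjugated diagonal units sum to 1, the trace of the image of `Y` is d⁻¹ times that of
`Y ⊗ 1`. -/
theorem isChannel_teleport [Nonempty K] {U : Fin N → Matrix K K ℂ}
    (hU : ∀ x, U x * (U x)ᴴ = 1)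
    {α : Matrix (L × K) (L × K) ℂ →ₗ[ℂ] Matrix (Fin N) (Fin N) ℂ} (hα : IsChannel α) :
    IsChannel (teleport U α) := by
  refine ⟨isCompletelyPositive_teleport U fun X hX => hα.1.posSemidef hX, fun Y => ?_⟩
  have hK : (Fintype.card K : ℂ) ≠ 0 := Nat.cast_ne_zero.2 Fintype.card_ne_zero
  have h1 : ∀ x, ∑ k, Y ⊗ₖ ((U x)ᴴ * Matrix.single k k 1 * U x) = Y ⊗ₖ (1 : Matrix K K ℂ) := by
    intro x
    have h2 : ∑ k, (U x)ᴴ * Matrix.single k k 1 * U x = 1 := by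
      rw [← Finset.sum_mul, ← Finset.mul_sum]
      have h3 : ∑ k : K, Matrix.single k k (1 : ℂ) = 1 := by
        ext i j
        simp only [Matrix.sum_apply, Matrix.single_apply, Matrix.one_apply, ite_and,
          Finset.sum_ite_eq', Finset.mem_univ, if_true]
      rw [h3, Matrix.mul_one, mul_eq_one_comm.1 (hU x)]
    rw [← h2]
    ext p q
    simp [Matrix.sum_apply, Finset.mul_sum]
  simp only [Matrix.trace, Matrix.diag_apply, teleport_apply]
  rw [← Finset.mul_sum, Finset.sum_comm]
  have h4 : ∀ x, ∑ k, α (Y ⊗ₖ ((U x)ᴴ * Matrix.single k k 1 * U x)) x x =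
      α (Y ⊗ₖ (1 : Matrix K K ℂ)) x x := by
    intro x
    rw [← h1 x, map_sum, Matrix.sum_apply]
  simp only [h4]
  have h5 := hα.2 (Y ⊗ₖ (1 : Matrix K K ℂ))
  rw [Matrix.trace_kronecker, Matrix.trace_one] at h5
  simp only [Matrix.trace, Matrix.diag_apply] at h5
  rw [h5]
  field_simp

end Teleportation

/-! ### Compactness and convexity of the set of channels -/

section Comparison

variable {H K L : Type*}

/-- The matrix coefficients of a linear map. -/
def coeff [DecidableEq H] : (Matrix H H ℂ →ₗ[ℂ] Matrix K K ℂ) →ₗ[ℂ] ((H × K) × (H × K) → ℂ) where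
  toFun φ p := φ (Matrix.single p.1.1 p.2.1 1) p.1.2 p.2.2
  map_add' _ _ := rfl
  map_smul' _ _ := rfl

theorem coeff_apply [DecidableEq H] (φ : Matrix H H ℂ →ₗ[ℂ] Matrix K K ℂ) (p q : H × K) :
    coeff φ (p, q) = φ (Matrix.single p.1 q.1 1) p.2 q.2 := rfl

variable [Fintype H]

/-- The matrix coefficients of a channel have norm at most one. -/
theorem IsChannel.norm_apply_single_le_one [Fintype K] [DecidableEq H]
    {φ : Matrix H H ℂ →ₗ[ℂ] Matrix K K ℂ}
    (hφ : IsChannel φ) (i j : H) (k l : K) : ‖φ (Matrix.single i j 1) k l‖ ≤ 1 := by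
  -- The coefficients of `φ` are the entries of its Choi matrix, which is positive; its diagonal is
  -- bounded because each `φ (single i i 1)` is positive of trace one.
  let ω : H × H → ℂ := fun p => if p.1 = p.2 then 1 else 0
  have hΩ : (Matrix.vecMulVec ω (star ω)).PosSemidef := Matrix.posSemidef_vecMulVec_self_star ω
  have hJ := hφ.1.isPositiveMap H _ hΩ
  have hb : ∀ i j, block (Matrix.vecMulVec ω (star ω)) i j = Matrix.single i j 1 := by
    intro i j
    ext a b
    simp only [block, Matrix.vecMulVec_apply, ω, Matrix.of_apply, Matrix.single_apply,
      Pi.star_apply]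
    by_cases h1 : a = i <;> by_cases h2 : b = j <;> simp [h1, h2, Ne.symm]
  have hd : ∀ (i : H) (k : K), 0 ≤ (φ (Matrix.single i i 1) k k).re ∧
      (φ (Matrix.single i i 1) k k).re ≤ 1 := by
    intro i k
    have hpos : ∀ k, 0 ≤ (φ (Matrix.single i i 1) k k).re := by
      intro k
      have := (Complex.nonneg_iff.1 (hJ.diag_nonneg (i := (k, i)))).1
      rwa [show QChannel.tensorId H φ (Matrix.vecMulVec ω (star ω)) (k, i) (k, i) =
        φ (block (Matrix.vecMulVec ω (star ω)) i i) k k from rfl, hb] at this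
    refine ⟨hpos k, ?_⟩
    have ht := congrArg Complex.re (hφ.2 (Matrix.single i i 1))
    rw [Matrix.trace_single_eq_same, Matrix.trace, Complex.re_sum] at ht
    simp only [Matrix.diag_apply, Complex.one_re] at ht
    rw [← ht]
    exact Finset.single_le_sum (f := fun k => (φ (Matrix.single i i 1) k k).re)
      (fun k _ => hpos k) (Finset.mem_univ k)
  have h := norm_apply_sq_le hJ (k, i) (l, j)
  rw [show QChannel.tensorId H φ (Matrix.vecMulVec ω (star ω)) (k, i) (l, j) =
        φ (block (Matrix.vecMulVec ω (star ω)) i j) k l from rfl,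
    show QChannel.tensorId H φ (Matrix.vecMulVec ω (star ω)) (k, i) (k, i) =
        φ (block (Matrix.vecMulVec ω (star ω)) i i) k k from rfl,
    show QChannel.tensorId H φ (Matrix.vecMulVec ω (star ω)) (l, j) (l, j) =
        φ (block (Matrix.vecMulVec ω (star ω)) j j) l l from rfl, hb, hb, hb] at h
  have h1 := mul_le_one₀ (hd i k).2 (hd j l).1 (hd j l).2
  nlinarith [norm_nonneg (φ (Matrix.single i j 1) k l)]

/-- The linear map with the given matrix coefficients. -/
def ofCoeff : ((H × K) × (H × K) → ℂ) →ₗ[ℂ] Matrix H H ℂ →ₗ[ℂ] Matrix K K ℂ :=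
  LinearMap.mk₂ ℂ (fun t Y => Matrix.of fun k l => ∑ i, ∑ j, Y i j * t ((i, k), (j, l)))
    (fun t t' Y => by ext; simp [mul_add, Finset.sum_add_distrib])
    (fun c t Y => by ext; simp [Finset.mul_sum, mul_left_comm])
    (fun t Y Y' => by ext; simp [add_mul, Finset.sum_add_distrib])
    (fun c t Y => by ext; simp [Finset.mul_sum, mul_assoc])

theorem ofCoeff_apply (t : (H × K) × (H × K) → ℂ) (Y : Matrix H H ℂ) (k l : K) :
    ofCoeff t Y k l = ∑ i, ∑ j, Y i j * t ((i, k), (j, l)) := rfl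

/-- The channels form a convex set. -/
theorem convex_channels [Fintype K] :
    Convex ℝ {t : (H × K) × (H × K) → ℂ | IsChannel (ofCoeff t)} := by
  intro s hs t ht a b ha hb hab
  have h : ofCoeff (a • s + b • t) = (a : ℂ) • ofCoeff s + (b : ℂ) • ofCoeff t := by
    rw [← map_smul, ← map_smul, ← map_add]
    rfl
  have ha' : (0 : ℂ) ≤ (a : ℂ) := Complex.zero_le_real.2 ha
  have hb' : (0 : ℂ) ≤ (b : ℂ) := Complex.zero_le_real.2 hb
  rw [Set.mem_ofPred_eq, h]
  refine ⟨fun m X hX => ?_, fun X => ?_⟩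
  · exact ((hs.1 m X hX).smul ha').add ((ht.1 m X hX).smul hb')
  · have hab' : (a : ℂ) + b = 1 := by exact_mod_cast hab
    simp only [LinearMap.add_apply, LinearMap.smul_apply, Matrix.trace_add, Matrix.trace_smul,
      hs.2, ht.2, smul_eq_mul, ← add_mul, hab', one_mul]

variable [DecidableEq H]

theorem apply_eq_sum_coeff (φ : Matrix H H ℂ →ₗ[ℂ] Matrix K K ℂ) (Y : Matrix H H ℂ) (k l : K) :
    φ Y k l = ∑ i, ∑ j, Y i j * coeff φ ((i, k), (j, l)) := by
  conv_lhs => rw [Matrix.matrix_eq_sum_single Y]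
  simp only [map_sum, Matrix.sum_apply, coeff_apply]
  refine Finset.sum_congr rfl fun i _ => Finset.sum_congr rfl fun j _ => ?_
  rw [show Matrix.single i j (Y i j) = Y i j • Matrix.single i j (1 : ℂ) by simp, map_smul,
    Matrix.smul_apply, smul_eq_mul]

theorem ofCoeff_coeff (φ : Matrix H H ℂ →ₗ[ℂ] Matrix K K ℂ) : ofCoeff (coeff φ) = φ := by
  refine LinearMap.ext fun Y => ?_
  ext k l
  rw [ofCoeff_apply, apply_eq_sum_coeff φ Y]

theorem coeff_injective : Function.Injective
    (coeff : (Matrix H H ℂ →ₗ[ℂ] Matrix K K ℂ) →ₗ[ℂ] ((H × K) × (H × K) → ℂ)) :=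
  Function.LeftInverse.injective ofCoeff_coeff

theorem coeff_ofCoeff (t : (H × K) × (H × K) → ℂ) : coeff (ofCoeff t) = t := by
  funext ⟨⟨i, k⟩, ⟨j, l⟩⟩
  rw [coeff_apply, ofCoeff_apply]
  simp [Matrix.single_apply, ite_and]

variable [Fintype K]

theorem entangledPairing_eq_sum_coeff (φ : Matrix H H ℂ →ₗ[ℂ] Matrix K K ℂ)
    (X : Matrix (H × K) (H × K) ℂ) :
    entangledPairing (tensorId K φ X) = ∑ p : (H × K) × (H × K), coeff φ p * X p.1 p.2 := by
  simp only [entangledPairing_tensorId, apply_eq_sum_coeff φ, Fintype.sum_prod_type, block,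
    Matrix.of_apply]
  rw [Finset.sum_congr rfl fun k _ => Finset.sum_comm, Finset.sum_comm]
  refine Finset.sum_congr rfl fun i _ => Finset.sum_congr rfl fun k _ => ?_
  rw [Finset.sum_comm]
  simp only [mul_comm]

theorem isClosed_posSemidef (n : Type*) [Fintype n] :
    IsClosed {M : Matrix n n ℂ | M.PosSemidef} := by
  simp only [Matrix.posSemidef_iff_dotProduct_mulVec, Set.ofPred_and, Set.ofPred_forall]
  refine IsClosed.inter ?_ (isClosed_iInter fun x => ?_)
  · exact isClosed_eq continuous_id.matrix_conjTranspose continuous_id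
  · exact isClosed_le continuous_const
      (continuous_const.dotProduct (continuous_id.matrix_mulVec continuous_const))

/-- The channels form a compact set. -/
theorem isCompact_channels :
    IsCompact {t : (H × K) × (H × K) → ℂ | IsChannel (ofCoeff t)} := by
  refine Metric.isCompact_of_isClosed_isBounded ?_ ?_
  · have h : {t : (H × K) × (H × K) → ℂ | IsChannel (ofCoeff t)} =
        (⋂ (m : ℕ) (X : Matrix (H × Fin m) (H × Fin m) ℂ) (_ : X.PosSemidef),
          {t | (tensorId (Fin m) (ofCoeff t) X).PosSemidef}) ∩
        ⋂ X : Matrix H H ℂ, {t | (ofCoeff t X).trace = X.trace} := by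
      ext t
      simp only [Set.mem_inter_iff, Set.mem_iInter, Set.mem_ofPred_eq]
      exact ⟨fun h => ⟨h.1, h.2⟩, fun h => ⟨h.1, h.2⟩⟩
    have hc : ∀ X : Matrix H H ℂ, Continuous fun t : (H × K) × (H × K) → ℂ => ofCoeff t X := by
      intro X
      refine continuous_matrix fun k l => ?_
      simp only [ofCoeff_apply]
      fun_prop
    rw [h]
    refine IsClosed.inter (isClosed_iInter fun m => isClosed_iInter fun X =>
      isClosed_iInter fun _ => ?_) (isClosed_iInter fun X => ?_)
    · refine (isClosed_posSemidef (K × Fin m)).preimage ?_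
      refine continuous_matrix fun p q => ?_
      exact (hc (block X p.2 q.2)).matrix_elem p.1 q.1
    · exact isClosed_eq (hc X).matrix_trace continuous_const
  · refine (Metric.isBounded_closedBall (x := 0) (r := 1)).subset fun t ht => ?_
    rw [mem_closedBall_zero_iff, pi_norm_le_iff_of_nonneg zero_le_one]
    intro p
    rw [← coeff_ofCoeff t]
    exact IsChannel.norm_apply_single_le_one ht _ _ _ _

variable [Fintype L] [DecidableEq L]

/-! ### Separation and the comparison argument -/

/-- Separation: a map that is dominated in every direction by postprocessings of `Ψ` is itself a
postprocessing of `Ψ`. -/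
theorem exists_comp_of_forall_entangledPairing_le (Φ : Matrix H H ℂ →ₗ[ℂ] Matrix K K ℂ)
    (Ψ : Matrix H H ℂ →ₗ[ℂ] Matrix L L ℂ)
    (h : ∀ X : Matrix (H × K) (H × K) ℂ, ∃ β : Matrix L L ℂ →ₗ[ℂ] Matrix K K ℂ, IsChannel β ∧
      (entangledPairing (tensorId K Φ X)).re ≤
        (entangledPairing (tensorId K (β ∘ₗ Ψ) X)).re) :
    ∃ β : Matrix L L ℂ →ₗ[ℂ] Matrix K K ℂ, IsChannel β ∧ Φ = β ∘ₗ Ψ := by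
  -- Precomposition with `Ψ` in coordinates; `g '' S` consists of the coefficients of all `β ∘ₗ Ψ`.
  let g : ((L × K) × (L × K) → ℂ) →ₗ[ℂ] ((H × K) × (H × K) → ℂ) :=
    coeff ∘ₗ LinearMap.lcomp ℂ _ Ψ ∘ₗ ofCoeff
  let S : Set ((L × K) × (L × K) → ℂ) := {t | IsChannel (ofCoeff t)}
  classical
  by_contra hne
  have hg : coeff Φ ∉ g '' S := by
    rintro ⟨t, ht, hgt⟩
    exact hne ⟨ofCoeff t, ht, (coeff_injective hgt).symm⟩
  have hcomp : IsCompact (g '' S) :=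
    isCompact_channels.image (LinearMap.continuous_of_finiteDimensional g)
  have hconv : Convex ℝ (g '' S) := convex_channels.linear_image (g.restrictScalars ℝ)
  obtain ⟨f, u, hf, hu⟩ := RCLike.geometric_hahn_banach_closed_point (𝕜 := ℂ) hconv
    hcomp.isClosed hg
  -- The operator that represents the separating functional `f` through the pairing.
  let X : Matrix (H × K) (H × K) ℂ :=
    Matrix.of fun p q => f fun r => if (p, q) = r then 1 else 0
  have hX : ∀ φ : Matrix H H ℂ →ₗ[ℂ] Matrix K K ℂ,
      f (coeff φ) = entangledPairing (tensorId K φ X) := by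
    intro φ
    rw [entangledPairing_eq_sum_coeff]
    exact LinearMap.pi_apply_eq_sum_univ (f : ((H × K) × (H × K) → ℂ) →ₗ[ℂ] ℂ) (coeff φ)
  obtain ⟨β, hβ, hle⟩ := h X
  have hβ' := hf (coeff (β ∘ₗ Ψ)) ⟨coeff β, by
    rw [Set.mem_ofPred_eq, ofCoeff_coeff]; exact hβ, by
    simp only [g, LinearMap.comp_apply, ofCoeff_coeff, LinearMap.lcomp_apply']⟩
  rw [hX] at hβ' hu
  exact absurd (hβ'.trans hu) (not_lt.2 hle)

/-- The total payoff for diagonal payoff matrices with constant shift `s`. -/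
theorem sum_payoff_diagonal {M : Type*} [Fintype M] {n N : ℕ} {τ : Fin n → Matrix M M ℂ}
    {γ : Matrix M M ℂ →ₗ[ℂ] Matrix (Fin N) (Fin N) ℂ} (hτ : IsExperiment τ) (hγ : IsChannel γ)
    (c : Fin N → Fin n → ℂ) (s : ℝ) :
    ∑ i, payoff τ i γ (fun i => Matrix.diagonal fun x => (((c x i).re + s : ℝ) : ℂ)) =
      (∑ x, γ (∑ i, c x i • τ i) x x).re + n * s := by
  have h1 : ∀ i, payoff τ i γ
      (fun i => Matrix.diagonal fun x => (((c x i).re + s : ℝ) : ℂ)) =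
        ∑ x, (c x i * γ (τ i) x x).re + s := by
    intro i
    have hst := hγ.isState (hτ i)
    have ht := congrArg Complex.re hst.2
    rw [Matrix.trace, Complex.re_sum] at ht
    simp only [Matrix.diag_apply, Complex.one_re] at ht
    have hs' : s = ∑ x, s * (γ (τ i) x x).re := by rw [← Finset.mul_sum, ht, mul_one]
    conv_rhs => rw [hs']
    rw [← Finset.sum_add_distrib, payoff, Matrix.trace, Complex.re_sum]
    refine Finset.sum_congr rfl fun x _ => ?_
    -- The diagonal entries of a state are real, so only the real part of the weight matters.
    have him := (Complex.nonneg_iff.1 (hst.1.diag_nonneg (i := x))).2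
    simp only [Matrix.diag_apply, Matrix.mul_diagonal, Complex.mul_re, Complex.ofReal_re,
      Complex.ofReal_im, ← him]
    ring
  simp only [h1, Finset.sum_add_distrib, map_sum, map_smul, Matrix.sum_apply,
    Matrix.smul_apply, smul_eq_mul, Complex.re_sum]
  rw [Finset.sum_comm]
  simp

/-- For classical decisions, deficiency gives the averaged inequality with arbitrary complex
weights: shifting the weights by a constant does not affect the comparison. -/
theorem IsDeficient.exists_re_sum_le {H H' : Type*} [Fintype H] [Fintype H'] {n N : ℕ}
    {σ : Fin n → Matrix H' H' ℂ} {ρ : Fin n → Matrix H H ℂ}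
    (h : IsDeficient 0 (diagAlgebra N) σ ρ) (hσ : IsExperiment σ) (hρ : IsExperiment ρ)
    {α : Matrix H H ℂ →ₗ[ℂ] Matrix (Fin N) (Fin N) ℂ} (hα : IsChannelInto (diagAlgebra N) α)
    (c : Fin N → Fin n → ℂ) :
    ∃ α' : Matrix H' H' ℂ →ₗ[ℂ] Matrix (Fin N) (Fin N) ℂ, IsChannel α' ∧
      (∑ x, α (∑ i, c x i • ρ i) x x).re ≤ (∑ x, α' (∑ i, c x i • σ i) x x).re := by
  -- Large enough to make every shifted payoff nonnegative.
  let s : ℝ := ∑ x, ∑ i, |(c x i).re|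
  have hs : ∀ x i, 0 ≤ (c x i).re + s := by
    intro x i
    have h1 : |(c x i).re| ≤ ∑ i, |(c x i).re| :=
      Finset.single_le_sum (f := fun i => |(c x i).re|) (fun _ _ => abs_nonneg _)
        (Finset.mem_univ i)
    have h2 : ∑ i, |(c x i).re| ≤ s :=
      Finset.single_le_sum (f := fun x => ∑ i, |(c x i).re|)
        (fun _ _ => Finset.sum_nonneg fun _ _ => abs_nonneg _) (Finset.mem_univ x)
    linarith [neg_abs_le (c x i).re]
  let G : Fin n → Matrix (Fin N) (Fin N) ℂ := fun i =>
    Matrix.diagonal fun x => (((c x i).re + s : ℝ) : ℂ)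
  obtain ⟨α', hα', hle⟩ := h G (fun i => ⟨Matrix.isDiag_diagonal _,
    Matrix.posSemidef_diagonal_iff.2 fun x => Complex.zero_le_real.2 (hs x i)⟩) α hα
  refine ⟨α', hα'.1, ?_⟩
  -- After summation over `i`, the shift adds `n * s` to both sides.
  have := Finset.sum_le_sum fun i (_ : i ∈ Finset.univ) => hle i
  simp only [zero_mul, add_zero] at this
  rw [sum_payoff_diagonal hρ hα.1, sum_payoff_diagonal hσ hα'.1] at this
  linarith

/-- Deficiency for a spanning experiment implies that `Φ` is a postprocessing of `Ψ`. -/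
theorem exists_comp_of_isDeficient [DecidableEq K] [Nonempty K]
    {Φ : Matrix H H ℂ →ₗ[ℂ] Matrix K K ℂ}
    (hΦ : IsChannel Φ) {Ψ : Matrix H H ℂ →ₗ[ℂ] Matrix L L ℂ} (hΨ : IsChannel Ψ) {n : ℕ}
    {ρ : Fin n → Matrix (H × K) (H × K) ℂ} (hρ : IsExperiment ρ)
    (hspan : Submodule.span ℂ (Set.range ρ) = ⊤)
    (hdef : IsDeficient 0 (diagAlgebra (Fintype.card K ^ 2))
      (fun i => tensorId K Ψ (ρ i)) (fun i => tensorId K Φ (ρ i))) :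
    ∃ β : Matrix L L ℂ →ₗ[ℂ] Matrix K K ℂ, IsChannel β ∧ Φ = β ∘ₗ Ψ := by
  obtain ⟨U, hU, hU'⟩ := exists_weyl K
  refine exists_comp_of_forall_entangledPairing_le Φ Ψ fun X => ?_
  have hc : ∀ x, ∃ c : Fin n → ℂ, ∑ i, c i • ρ i = mulRight H (U x)ᴴ (U x) X := fun x =>
    (Submodule.mem_span_range_iff_exists_fun ℂ).1 (hspan ▸ Submodule.mem_top)
  choose c hc using hc
  obtain ⟨α, hα, hle⟩ := hdef.exists_re_sum_le (fun i => hΨ.tensorId.isState (hρ i))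
    (fun i => hΦ.tensorId.isState (hρ i)) (isChannelInto_bellMap hU') c
  refine ⟨teleport U α, isChannel_teleport hU hα, ?_⟩
  simp only [← map_smul, ← map_sum, hc, tensorId_mulRight, bellMap_mulRight U hU] at hle
  have hK : (Fintype.card K : ℂ) ≠ 0 := Nat.cast_ne_zero.2 Fintype.card_ne_zero
  have hK' : (0 : ℝ) < Fintype.card K := Nat.cast_pos.2 Fintype.card_pos
  rw [tensorId_comp, LinearMap.comp_apply, entangledPairing_teleport]
  -- There are d² outcomes of value d⁻¹ times the pairing, hence the factor d that cancels the d⁻¹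
  -- of teleportation.
  have h1 : (∑ x : Fin (Fintype.card K ^ 2), (Fintype.card K : ℂ)⁻¹ *
      entangledPairing (tensorId K Φ X)) =
      (Fintype.card K : ℝ) * entangledPairing (tensorId K Φ X) := by
    simp only [Finset.sum_const, Finset.card_univ, Fintype.card_fin, nsmul_eq_mul]
    push_cast
    field_simp
  rw [h1, Complex.re_ofReal_mul] at hle
  rw [← Complex.ofReal_natCast, ← Complex.ofReal_inv, Complex.re_ofReal_mul,
    le_inv_mul_iff₀ hK']
  exact hle

end Comparison

end QChannel

theorem mainTheorem8 {H K K' : Type u} [Fintype H] [Fintype K] [Fintype K'] [Nonempty H]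
    (Φ : Matrix H H ℂ →ₗ[ℂ] Matrix K K ℂ) (hΦ : QChannel.IsChannel Φ)
    (Ψ : Matrix H H ℂ →ₗ[ℂ] Matrix K' K' ℂ) (hΨ : QChannel.IsChannel Ψ) :
    List.TFAE [
      ∃ α : Matrix K' K' ℂ →ₗ[ℂ] Matrix K K ℂ, QChannel.IsChannel α ∧ Φ = α ∘ₗ Ψ,
      ∀ (D : Type u) [Fintype D] (n : ℕ) (ρ : Fin n → Matrix (H × D) (H × D) ℂ),
        QChannel.IsExperiment ρ → ∀ N : ℕ,
          QChannel.IsDeficient 0 (QChannel.diagAlgebra N)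
            (fun i => QChannel.tensorId D Ψ (ρ i)) (fun i => QChannel.tensorId D Φ (ρ i)),
      ∃ (n : ℕ) (ρ : Fin n → Matrix (H × K) (H × K) ℂ),
        QChannel.IsExperiment ρ ∧ Submodule.span ℂ (Set.range ρ) = ⊤ ∧
          QChannel.IsDeficient 0 (QChannel.diagAlgebra (Fintype.card K ^ 2))
            (fun i => QChannel.tensorId K Ψ (ρ i)) (fun i => QChannel.tensorId K Φ (ρ i))] := by
  classical
  -- Trace preservation at the identity of the nonzero space `H` excludes `K = {0}`, so d is
  -- invertible.
  have : Nonempty K := by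
    by_contra hK
    rw [not_nonempty_iff] at hK
    have h := hΦ.2 1
    rw [Matrix.trace_one, Matrix.trace, Finset.univ_eq_empty, Finset.sum_empty] at h
    exact Fintype.card_ne_zero (Nat.cast_eq_zero.1 h.symm)
  tfae_have 1 → 2 := by
    rintro ⟨α, hα, h⟩ D _ n ρ - N
    exact QChannel.isDeficient_of_comp hα h ρ
  tfae_have 2 → 3 := by
    intro h
    obtain ⟨n, ρ, hρ, hspan⟩ := QChannel.exists_isExperiment_span_eq_top (H × K)
    exact ⟨n, ρ, hρ, hspan, h K n ρ hρ _⟩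
  tfae_have 3 → 1 := by
    rintro ⟨n, ρ, hρ, hspan, hdef⟩
    exact QChannel.exists_comp_of_isDeficient hΦ hΨ hρ hspan hdef
  tfae_finish
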